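/- **Setting.** Let $d\in\{2,3\}$, let $\Omega\subset\mathbb R^d$ be a bounded polygonal domain, $Y=[0,1]^d$, and let $Y_s\subset(0,1)^d$ be compact (the solid part of the cell). For $0<\varepsilon\le 1$ put $$\Omega^\varepsilon=\Omega\setminus\bigcup\{\varepsilon(m+Y_s): m\in\mathbb Z^d,\ \varepsilon(m+Y)\subset\Omega\},\qquad \Gamma^{\rm ext}=\partial\Omega^\varepsilon\cap\partial\Omega,$$ and consider only those $\varepsilon$ for which $\Omega^\varepsilon$ is connected with $C^{0,1}$ boundary. Let $V^\varepsilon=\{u\in H^1(\Omega^\varepsilon): u=0\text{ on }\Gamma^{\rm ext}\}$, and let $C_p>0$ denote an $\varepsilon$-independent constant of the Poincaré inequality $\|u\|_{L^2(\Omega^\varepsilon)}^2\le C_p\|\nabla u\|_{L^2(\Omega^\varepsilon)}^2$, $u\in V^\varepsilon$. **Assumptions.** (A1) $\mathbf A=(a_{ij}):\mathbb R^d\to\mathbb R^{d\times d}$ is essentially bounded, $Y$-periodic, symmetric, globally Lipschitz, and $\underline\gamma|\xi|^2\le\sum_{i,j}a_{ij}(y)\xi_i\xi_j\le\overline\gamma|\xi|^2$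 for all $y,\xi\in\mathbb R^d$, with constants $\underline\gamma,\overline\gamma>0$. (A2) $\mathcal R:\mathbb R\to\mathbb R$ is Lipschitz and degenerate at a point $x_0$: there are $\delta_0,\delta_1,r>0$ such that $0\le\mathcal R'\le\delta_1$ a.e.; if the one-sided limits of $\mathcal R'$ at $s$ exist and have product $0$, then $s=x_0$; $\delta_0\le\mathcal R'\le\delta_1$ a.e. outside the ball $\mathcal B(x_0,r)$; and $\mathcal R'$ is non-decreasing on $[x_0,x_0+r]$ (at the points where it exists). (A3) $f\in L^2(\Omega)$. Let $\sigma>0$ and $C_{\mathcal R}$ be constants. For a parameter $\gamma>0$, a regularization $\mathcal R_\gamma$ of $\mathcal R$ is a Lipschitz function with $\gamma\delta_0\le\mathcal R_\gamma'\le\delta_1$ a.e. and $|\mathcal R-\mathcal R_\gamma|\le C_{\mathcal R}\gamma^\sigma$ on $\mathbb R$. **Theorem.** Let $\alpha\ge0$, $\eta>0$ and assume (A1)–(A3). There is a constant $C>0$, independent of $\varepsilon$, of $k$ and of the choice of the parameters and regularizations, such that the following holds. Let $(\gamma_k)_{k\ge1}$ be positive and non-increasing, let $\mathcal R_{\gamma_k}$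 be regularizations of $\mathcal R$ as above, and let $M=\eta+\varepsilon^\alpha\delta_1$. Let $u_\varepsilon^0=0$ and let $u_\varepsilon^k\in V^\varepsilon$, $k\ge1$, satisfy for all $\varphi\in V^\varepsilon$ $$\int_{\Omega^\varepsilon}\mathbf A\left(\tfrac x\varepsilon\right)\nabla u_\varepsilon^k\cdot\nabla\varphi\,dx+M\langle u_\varepsilon^k,\varphi\rangle=\langle f,\varphi\rangle+M\langle u_\varepsilon^{k-1},\varphi\rangle-\varepsilon^\alpha\langle\mathcal R_{\gamma_k}(u_\varepsilon^{k-1}),\varphi\rangle,$$ where $\langle\cdot,\cdot\rangle$ is the inner product of $L^2(\Omega^\varepsilon)$. Then, for all $k\ge2$, with all norms in $L^2(\Omega^\varepsilon)$, $$\frac{\underline\gamma}{\eta+\delta_1+\underline\gamma C_p^{-1}}\|\nabla u_\varepsilon^k-\nabla u_\varepsilon^{k-1}\|^2+\|u_\varepsilon^k-u_\varepsilon^{k-1}\|^2\le\frac{C\gamma_{k-1}^{2\sigma}}{\gamma_k}+C\sum_{j=2}^{k-1}\left(\frac{M}{\underline\gamma C_p^{-1}+M}\right)^{k-j}\frac{\gamma_{j-1}^{2\sigma}}{\gamma_j}+\|u_\varepsilon^1\|^2\left(\frac{M}{\underline\gamma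 C_p^{-1}+M}\right)^{k-1}.$$ -/

import Mathlib

open MeasureTheory Set Filter Topology
open scoped NNReal ContDiff

noncomputable section

/-- The Euclidean space `ℝ^d`. -/
abbrev Space (d : ℕ) : Type := EuclideanSpace ℝ (Fin d)

/-! ### Geometry of the perforated medium -/

/-- The integer vector `m ∈ ℤ^d`, seen in `ℝ^d`. -/
def latticePoint {d : ℕ} (m : Fin d → ℤ) : Space d :=
  WithLp.toLp 2 (fun i => (m i : ℝ))

/-- The scaled and shifted copy `ε (m + S)` of a subset `S` of the unit cell. -/
def scaledCopy {d : ℕ} (ε : ℝ) (m : Fin d → ℤ) (S : Set (Space d)) : Set (Space d) :=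
  (fun y => ε • (latticePoint m + y)) '' S

/-- The closed periodicity cell `Y = [0,1]^d`. -/
def unitCell (d : ℕ) : Set (Space d) := {y | ∀ i, 0 ≤ y i ∧ y i ≤ 1}

/-- The open periodicity cell `(0,1)^d`. -/
def openUnitCell (d : ℕ) : Set (Space d) := {y | ∀ i, 0 < y i ∧ y i < 1}

/-- A polygonal bounded domain: a bounded, connected, nonempty open set whose boundary is
contained in a finite union of affine hyperplanes. -/
structure IsPolygonalDomain {d : ℕ} (Ω : Set (Space d)) : Prop where
  isOpen : IsOpen Ω
  isConnected : IsConnected Ω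
  isBounded : Bornology.IsBounded Ω
  polygonal : ∃ S : Finset (Space d × ℝ), (∀ p ∈ S, p.1 ≠ 0) ∧
    frontier Ω ⊆ ⋃ p ∈ S, {x | inner ℝ p.1 x = p.2}

/-- The boundary of `U` is of class `C^{0,1}`: near each of its points, in a suitable system of
orthonormal coordinates with last axis `ν`, the set `U` is the subgraph of a Lipschitz function
`h` of the remaining coordinates (`h` does not change along `ν`). -/
def HasLipschitzBoundary {d : ℕ} (U : Set (Space d)) : Prop :=
  ∀ x ∈ frontier U, ∃ ν : Space d, ‖ν‖ = 1 ∧ ∃ (h : Space d → ℝ) (K : ℝ≥0),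
    LipschitzWith K h ∧ (∀ (y : Space d) (t : ℝ), h (y + t • ν) = h y) ∧
    ∀ᶠ y in 𝓝 x, (y ∈ U ↔ inner ℝ ν y < h y)

/-- The perforated domain `Ω^ε`: from every cell `ε (m + Y)` contained in `Ω` the copy
`ε (m + Ys)` of the solid part `Ys` of the unit cell is removed. -/
def perforated {d : ℕ} (Ω Ys : Set (Space d)) (ε : ℝ) : Set (Space d) :=
  Ω \ ⋃ m ∈ {m : Fin d → ℤ | scaledCopy ε m (unitCell d) ⊆ Ω}, scaledCopy ε m Ys

/-- The exterior boundary `Γ^ext`: the part of the boundary of `Ω^ε` lying on the boundary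
of `Ω`. -/
def exteriorBoundary {d : ℕ} (Ω Ys : Set (Space d)) (ε : ℝ) : Set (Space d) :=
  frontier (perforated Ω Ys ε) ∩ frontier Ω

/-- The values `ε` of the scale parameter, `0 < ε ≤ 1`, for which `Ω^ε` is a connected domain
with `C^{0,1}` boundary. -/
def admissibleScales {d : ℕ} (Ω Ys : Set (Space d)) : Set ℝ :=
  {ε | 0 < ε ∧ ε ≤ 1 ∧ IsConnected (perforated Ω Ys ε) ∧
    HasLipschitzBoundary (perforated Ω Ys ε)}

/-! ### Sobolev spaces -/

/-- The squared `L²(U)` norm of a scalar or vector valued function. -/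
def l2Sq {d : ℕ} {F : Type*} [NormedAddCommGroup F] (U : Set (Space d)) (v : Space d → F) : ℝ :=
  ∫ x in U, ‖v x‖ ^ 2

/-- A function of `H¹(U)`, given by a representative together with a representative of its weak
gradient (which is determined almost everywhere on `U` by the function). -/
structure H1 {d : ℕ} (U : Set (Space d)) where
  /-- the function -/
  val : Space d → ℝ
  /-- its weak gradient -/
  grad : Space d → Space d
  memLp_val : MemLp val 2 (volume.restrict U)
  memLp_grad : MemLp grad 2 (volume.restrict U)
  weak_grad : ∀ φ : Space d → ℝ, ContDiff ℝ ∞ φ → HasCompactSupport φ → tsupport φ ⊆ U →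
    ∀ i : Fin d, ∫ x in U, val x * (gradient φ x) i = - ∫ x in U, (grad x) i * φ x

/-- `u ∈ H¹(U)` vanishes on the part `Γ` of the boundary of `U`: it is a limit, in the norm of
`H¹(U)`, of restrictions of smooth functions with compact support in the complement of `Γ`. -/
def VanishesOn {d : ℕ} {U : Set (Space d)} (Γ : Set (Space d)) (u : H1 U) : Prop :=
  ∀ δ : ℝ, 0 < δ → ∃ φ : Space d → ℝ, ContDiff ℝ ∞ φ ∧ HasCompactSupport φ ∧
    Disjoint (tsupport φ) Γ ∧
    l2Sq U (fun x => u.val x - φ x) + l2Sq U (fun x => u.grad x - gradient φ x) < δ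

/-- The space `V^ε` of the functions in `H¹(Ω^ε)` that vanish on `Γ^ext`. -/
def spaceV {d : ℕ} (Ω Ys : Set (Space d)) (ε : ℝ) : Set (H1 (perforated Ω Ys ε)) :=
  {u | VanishesOn (exteriorBoundary Ω Ys ε) u}

/-- `Cp` is a constant, independent of `ε`, of the Poincaré inequality in the spaces `V^ε`. -/
def IsPoincareConstant {d : ℕ} (Ω Ys : Set (Space d)) (Cp : ℝ) : Prop :=
  0 < Cp ∧ ∀ ε ∈ admissibleScales Ω Ys, ∀ u ∈ spaceV Ω Ys ε,
    l2Sq (perforated Ω Ys ε) u.val ≤ Cp * l2Sq (perforated Ω Ys ε) u.grad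

/-! ### Data of the problem -/

/-- The assumption on the diffusion matrix `A`: essentially bounded, periodic with respect to the
unit cell, symmetric, globally Lipschitz and uniformly elliptic with the constants
`gLow, gHigh`. -/
structure IsDiffusion {d : ℕ} (A : Space d → Matrix (Fin d) (Fin d) ℝ) (gLow gHigh : ℝ) :
    Prop where
  gLow_pos : 0 < gLow
  gHigh_pos : 0 < gHigh
  ess_bounded : ∃ B : ℝ, ∀ᵐ y, ∀ i j, |A y i j| ≤ B
  periodic : ∀ (y : Space d) (m : Fin d → ℤ), A (y + latticePoint m) = A y
  symmetric : ∀ y, (A y).IsSymm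
  lipschitz : ∃ L : ℝ≥0, ∀ i j, LipschitzWith L (fun y => A y i j)
  elliptic : ∀ y ξ : Space d, gLow * ‖ξ‖ ^ 2 ≤ ∑ i, ∑ j, A y i j * ξ i * ξ j ∧
    ∑ i, ∑ j, A y i j * ξ i * ξ j ≤ gHigh * ‖ξ‖ ^ 2

/-- `F` is degenerate at the point `x₀`, with the constants `δ₀, δ₁`. The derivative `F'` of the
Lipschitz function `F` exists almost everywhere; its one-sided limits and its monotonicity refer
to the points where it exists. -/
structure IsDegenerateAt (F : ℝ → ℝ) (x₀ δ₀ δ₁ : ℝ) : Prop where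
  δ₀_pos : 0 < δ₀
  δ₁_pos : 0 < δ₁
  lipschitz : ∃ K : ℝ≥0, LipschitzWith K F
  deriv_bounds : ∀ᵐ x, 0 ≤ deriv F x ∧ deriv F x ≤ δ₁
  degenerate_only : ∀ s lp lm : ℝ,
    Tendsto (deriv F) (𝓝[{x | s < x ∧ DifferentiableAt ℝ F x}] s) (𝓝 lp) →
    Tendsto (deriv F) (𝓝[{x | x < s ∧ DifferentiableAt ℝ F x}] s) (𝓝 lm) →
    lp * lm = 0 → s = x₀
  local_behaviour : ∃ r : ℝ, 0 < r ∧
    (∀ᵐ x, x ∉ Metric.ball x₀ r → δ₀ ≤ deriv F x ∧ deriv F x ≤ δ₁) ∧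
    MonotoneOn (deriv F) {x | x₀ ≤ x ∧ x ≤ x₀ + r ∧ DifferentiableAt ℝ F x}

/-- `Fγ` is a regularization, with parameter `γ`, of the degenerate function `F` with the constants
`δ₀, δ₁`: `0 < γ δ₀ ≤ Fγ' ≤ δ₁` and `|F - Fγ| ≤ CR γ^σ`. -/
structure IsRegularization (F : ℝ → ℝ) (δ₀ δ₁ CR σ γ : ℝ) (Fγ : ℝ → ℝ) : Prop where
  γ_pos : 0 < γ
  lipschitz : ∃ K : ℝ≥0, LipschitzWith K Fγ
  deriv_bounds : ∀ᵐ x, γ * δ₀ ≤ deriv Fγ x ∧ deriv Fγ x ≤ δ₁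
  close : ∀ x, |F x - Fγ x| ≤ CR * γ ^ σ

/-! ### The linearized problems -/

/-- The bilinear form `a(u, φ) = ∫_{Ω^ε} A(x/ε) ∇u · ∇φ dx`. -/
def bilinearForm {d : ℕ} {U : Set (Space d)} (A : Space d → Matrix (Fin d) (Fin d) ℝ) (ε : ℝ)
    (u φ : H1 U) : ℝ :=
  ∫ x in U, ∑ i, ∑ j, A (ε⁻¹ • x) i j * (u.grad x) j * (φ.grad x) i

/-- `u` is a sequence of iterates `u_ε^k ∈ V^ε` of the linearized problems with stabilization
constant `M`, regularization parameters `γ k` and regularized reactions `Rreg (γ k)`: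
`u_ε^0 = 0`, and for `k ≥ 1` and all `φ ∈ V^ε`
`a(u^k, φ) + M ⟨u^k, φ⟩ = ⟨f, φ⟩ + M ⟨u^{k-1}, φ⟩ - ε^α ⟨Rreg (γ k) (u^{k-1}), φ⟩`. -/
structure IsIteration {d : ℕ} (Ω Ys : Set (Space d)) (A : Space d → Matrix (Fin d) (Fin d) ℝ)
    (f : Space d → ℝ) (α M ε : ℝ) (γ : ℕ → ℝ) (Rreg : ℝ → ℝ → ℝ)
    (u : ℕ → H1 (perforated Ω Ys ε)) : Prop where
  initial : (u 0).val =ᵐ[volume.restrict (perforated Ω Ys ε)] 0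
  mem_spaceV : ∀ k, u k ∈ spaceV Ω Ys ε
  equation : ∀ k, 1 ≤ k → ∀ φ ∈ spaceV Ω Ys ε,
    bilinearForm A ε (u k) φ + M * ∫ x in perforated Ω Ys ε, (u k).val x * φ.val x =
      (∫ x in perforated Ω Ys ε, f x * φ.val x)
        + M * (∫ x in perforated Ω Ys ε, (u (k - 1)).val x * φ.val x)
        - ε ^ α * ∫ x in perforated Ω Ys ε, Rreg (γ k) ((u (k - 1)).val x) * φ.val x

end

/-! ### Lipschitz functions with almost everywhere bounded derivative -/

/-! Subtract the equations of two consecutive steps and test with the increment `w = u (k+1) - u k`.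
With `v = u k - u (k-1)` and `e = ε ^ α`, the reaction difference splits as `θ v - g`: a slope `θ`
of the new regularization, in `[γ (k+1) δ₀, δ₁]`, and the change `g` of regularization at a fixed
argument, at most `2 CR γ_k^σ`. The right-hand side is then `(M - e θ) v + e g` against `w`, and `M
≥ e δ₁` gives `0 ≤ M - e θ ≤ M - e γ (k+1) δ₀`.

This small gap below `M` is spent entirely on absorbing `g` by a weighted Young inequality
(`young_contraction`). The price is `g² / (γ (k+1) δ₀)`, whence the quotients `γ_{j-1}^{2σ} / γ_j`;
the powers of `e` cancel up to a factor `e ≤ 1`, so no negative power of `ε` survives. The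
contraction itself comes from diffusion: by ellipticity and Poincaré, part of the form adds `gLow /
Cp` to the coefficient `M` of `‖w‖²`, which gives the ratio `M / (gLow / Cp + M)`
(`IsIteration.step`). A discrete Gronwall argument (`le_sum_of_contraction`) concludes. -/

lemma LipschitzWith.increment_bounds {F : ℝ → ℝ} {K : ℝ≥0} (hF : LipschitzWith K F) {l m : ℝ}
    (h : ∀ᵐ x, l ≤ deriv F x ∧ deriv F x ≤ m) {a b : ℝ} (hab : a ≤ b) :
    l * (b - a) ≤ F b - F a ∧ F b - F a ≤ m * (b - a) := by
  have hac : AbsolutelyContinuousOnInterval F a b :=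
    (hF.lipschitzOnWith (s := uIcc a b)).absolutelyContinuousOnInterval
  have hint := hac.intervalIntegrable_deriv
  rw [← hac.integral_deriv_eq_sub]
  constructor
  · have := intervalIntegral.integral_mono_ae hab (intervalIntegrable_const (c := l)) hint
      (h.mono fun x hx => hx.1)
    simpa [mul_comm] using this
  · have := intervalIntegral.integral_mono_ae hab hint (intervalIntegrable_const (c := m))
      (h.mono fun x hx => hx.2)
    simpa [mul_comm] using this

lemma LipschitzWith.exists_slope {F : ℝ → ℝ} {K : ℝ≥0} (hF : LipschitzWith K F) {l m : ℝ}
    (h : ∀ᵐ x, l ≤ deriv F x ∧ deriv F x ≤ m) (a b : ℝ) :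
    ∃ θ, l ≤ θ ∧ θ ≤ m ∧ F b - F a = θ * (b - a) := by
  rcases lt_trichotomy a b with hab | rfl | hab
  · obtain ⟨h₁, h₂⟩ := hF.increment_bounds h hab.le
    have hpos : 0 < b - a := sub_pos.2 hab
    exact ⟨(F b - F a) / (b - a), (le_div_iff₀ hpos).2 h₁, (div_le_iff₀ hpos).2 h₂, by field_simp⟩
  -- When `a = b` any number in `[l, m]` serves; the derivative at a point where the bounds hold is
  -- one.
  · obtain ⟨x, hx⟩ := h.exists
    exact ⟨deriv F x, hx.1, hx.2, by simp⟩
  · obtain ⟨h₁, h₂⟩ := hF.increment_bounds h hab.le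
    have hpos : 0 < a - b := sub_pos.2 hab
    refine ⟨(F a - F b) / (a - b), (le_div_iff₀ hpos).2 h₁, (div_le_iff₀ hpos).2 h₂, ?_⟩
    field_simp
    ring

lemma IsRegularization.const_nonneg {F Fγ : ℝ → ℝ} {δ₀ δ₁ CR σ γ : ℝ}
    (h : IsRegularization F δ₀ δ₁ CR σ γ Fγ) : 0 ≤ CR :=
  nonneg_of_mul_nonneg_left ((abs_nonneg _).trans (h.close 0)) (Real.rpow_pos_of_pos h.γ_pos σ)

/-- The pointwise estimate behind the contraction property of the linearized scheme. -/
lemma young_contraction {M q e τ a w g : ℝ} (he : 0 < e) (he1 : e ≤ 1) (hτ : 0 < τ)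
    (hM : e * τ ≤ M) (hq : |q| ≤ M - e * τ) :
    2 * ((q * a + e * g) * w) ≤ M * w ^ 2 + (M * a ^ 2 + 2 * g ^ 2 / τ) := by
  have hMpos : 0 < M := (mul_pos he hτ).trans_le hM
  have h₁ : 2 * ((q * a + e * g) * w) ≤ M * w ^ 2 + (q * a + e * g) ^ 2 / M := by
    have : 0 ≤ (M * w - (q * a + e * g)) ^ 2 / M := by positivity
    have h₂ : (M * w - (q * a + e * g)) ^ 2 / M
        = M * w ^ 2 - 2 * ((q * a + e * g) * w) + (q * a + e * g) ^ 2 / M := by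
      field_simp
      ring
    linarith
  have h₂ : (q * a + e * g) ^ 2 / M ≤ M * a ^ 2 + 2 * g ^ 2 / τ := by
    set t := e * τ with ht
    have htpos : 0 < t := mul_pos he hτ
    -- The weight `t / M` is small enough for the gap `|q| ≤ M - t` to pay for it: `(1 + t / M) (M -
    -- t)² ≤ M²`.
    have hsplit : (q * a + e * g) ^ 2 ≤
        (1 + t / M) * (q * a) ^ 2 + (1 + M / t) * (e * g) ^ 2 := by
      have : 0 ≤ (t * (q * a) - M * (e * g)) ^ 2 / (t * M) := by positivity
      have h₃ : (t * (q * a) - M * (e * g)) ^ 2 / (t * M)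
          = t / M * (q * a) ^ 2 - 2 * (q * a) * (e * g) + M / t * (e * g) ^ 2 := by
        field_simp
        ring
      linarith
    have hfst : (1 + t / M) * (q * a) ^ 2 ≤ M * (M * a ^ 2) := by
      have hq2 : q ^ 2 ≤ (M - t) ^ 2 := sq_le_sq' (by linarith [neg_abs_le q])
        ((le_abs_self q).trans hq)
      have h₃ : (1 + t / M) * (M - t) ^ 2 ≤ M ^ 2 := by
        have h₄ : (1 + t / M) * (M - t) ^ 2 = (M ^ 2 - t ^ 2) * ((M - t) / M) := by
          field_simp
          ring
        have h₅ : (M - t) / M ≤ 1 := (div_le_one hMpos).2 (by linarith)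
        have h₆ : 0 ≤ M ^ 2 - t ^ 2 := by nlinarith
        rw [h₄]
        nlinarith [mul_le_mul_of_nonneg_left h₅ h₆]
      calc (1 + t / M) * (q * a) ^ 2 = (1 + t / M) * q ^ 2 * a ^ 2 := by ring
        _ ≤ (1 + t / M) * (M - t) ^ 2 * a ^ 2 := by gcongr
        _ ≤ M ^ 2 * a ^ 2 := by gcongr
        _ = M * (M * a ^ 2) := by ring
    have hsnd : (1 + M / t) * (e * g) ^ 2 ≤ M * (2 * g ^ 2 / τ) := by
      have h₃ : 1 + M / t ≤ 2 * M / t := by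
        have : 1 ≤ M / t := (one_le_div htpos).2 hM
        have h₄ : 2 * M / t = M / t + M / t := by ring
        linarith
      -- Since `t = e τ`, one factor of `e²` cancels and the other is bounded by `1`.
      calc (1 + M / t) * (e * g) ^ 2 ≤ 2 * M / t * (e * g) ^ 2 := by gcongr
        _ = e * (M * (2 * g ^ 2 / τ)) := by
          rw [ht]
          field_simp
        _ ≤ 1 * (M * (2 * g ^ 2 / τ)) := by gcongr
        _ = M * (2 * g ^ 2 / τ) := one_mul _
    rw [div_le_iff₀ hMpos]
    linarith
  linarith

/-- Inserting `Fγ q` separates the change of argument, governed by a slope of `Fγ`, from the change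
of regularization at `q`. Only the slope of the newer `Fγ` enters, so the smaller parameter `γ` is
in the denominator; both errors in `g` are measured by the larger `γ'`. -/
lemma IsRegularization.young_le {F Fγ Fγ' : ℝ → ℝ} {δ₀ δ₁ CR σ γ γ' : ℝ} (hδ₀ : 0 < δ₀)
    (hσ : 0 < σ) (h : IsRegularization F δ₀ δ₁ CR σ γ Fγ)
    (h' : IsRegularization F δ₀ δ₁ CR σ γ' Fγ') (hγ : γ ≤ γ') {η e M : ℝ} (hη : 0 < η)
    (he : 0 < e) (he1 : e ≤ 1) (hM : M = η + e * δ₁) (p q w : ℝ) :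
    2 * (M * ((p - q) * w) - e * ((Fγ p - Fγ' q) * w)) ≤
      M * w ^ 2 + (M * (p - q) ^ 2 + 8 * CR ^ 2 / δ₀ * (γ' ^ (2 * σ) / γ)) := by
  obtain ⟨K, hK⟩ := h.lipschitz
  obtain ⟨θ, hθ₀, hθ₁, hθ⟩ := hK.exists_slope h.deriv_bounds q p
  have hτ : 0 < γ * δ₀ := mul_pos h.γ_pos hδ₀
  set g := Fγ' q - Fγ q with hg
  have hg2 : g ^ 2 ≤ 4 * CR ^ 2 * γ' ^ (2 * σ) := by
    have h₁ := abs_le.1 (h.close q)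
    have h₂ := abs_le.1 (h'.close q)
    have h₃ : CR * γ ^ σ ≤ CR * γ' ^ σ :=
      mul_le_mul_of_nonneg_left (Real.rpow_le_rpow h.γ_pos.le hγ hσ.le) h.const_nonneg
    have h₄ : γ' ^ (2 * σ) = (γ' ^ σ) ^ 2 := by
      rw [mul_comm, Real.rpow_mul h'.γ_pos.le]
      norm_num
    calc g ^ 2 ≤ (2 * (CR * γ' ^ σ)) ^ 2 := sq_le_sq' (by linarith [h₁.1, h₁.2, h₂.1, h₂.2])
          (by linarith [h₁.1, h₁.2, h₂.1, h₂.2])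
      _ = 4 * CR ^ 2 * γ' ^ (2 * σ) := by
        rw [h₄]
        ring
  have heτ : e * (γ * δ₀) ≤ e * θ := by gcongr
  have heθ : e * θ ≤ e * δ₁ := by gcongr
  have key := young_contraction (M := M) (q := M - e * θ) (a := p - q) (w := w) (g := g) he he1 hτ
    (by linarith) (by rw [abs_of_nonneg] <;> linarith)
  have hrw : M * ((p - q) * w) - e * ((Fγ p - Fγ' q) * w)
      = ((M - e * θ) * (p - q) + e * g) * w := by
    have : Fγ p - Fγ' q = θ * (p - q) - g := by
      rw [← hθ, hg]
      ring
    rw [this]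
    ring
  have hlast : 2 * g ^ 2 / (γ * δ₀) ≤ 8 * CR ^ 2 / δ₀ * (γ' ^ (2 * σ) / γ) := by
    have hγ0 := h.γ_pos
    calc 2 * g ^ 2 / (γ * δ₀) ≤ 2 * (4 * CR ^ 2 * γ' ^ (2 * σ)) / (γ * δ₀) := by gcongr
      _ = 8 * CR ^ 2 / δ₀ * (γ' ^ (2 * σ) / γ) := by
        field_simp
        ring
  rw [hrw]
  linarith

/-! ### The squared `L²` norm -/

section L2

variable {d : ℕ} {U : Set (Space d)} {F : Type*} [NormedAddCommGroup F]

lemma l2Sq_nonneg (v : Space d → F) : 0 ≤ l2Sq U v :=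
  integral_nonneg fun _ => by positivity

lemma MeasureTheory.MemLp.integrable_norm_sq {v : Space d → F}
    (hv : MemLp v 2 (volume.restrict U)) :
    Integrable (fun x => ‖v x‖ ^ 2) (volume.restrict U) :=
  (memLp_two_iff_integrable_sq_norm hv.1).1 hv

lemma l2Sq_sub_le {v w : Space d → F} (hv : MemLp v 2 (volume.restrict U))
    (hw : MemLp w 2 (volume.restrict U)) :
    l2Sq U (fun x => v x - w x) ≤ 2 * l2Sq U v + 2 * l2Sq U w := by
  unfold l2Sq
  rw [← integral_const_mul, ← integral_const_mul,
    ← integral_add (hv.integrable_norm_sq.const_mul 2) (hw.integrable_norm_sq.const_mul 2)]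
  refine integral_mono (hv.sub hw).integrable_norm_sq
    ((hv.integrable_norm_sq.const_mul 2).add (hw.integrable_norm_sq.const_mul 2)) fun x => ?_
  have h₁ : ‖v x - w x‖ ^ 2 ≤ (‖v x‖ + ‖w x‖) ^ 2 := by
    gcongr
    exact norm_sub_le _ _
  have h₂ : 0 ≤ (‖v x‖ - ‖w x‖) ^ 2 := sq_nonneg _
  change ‖v x - w x‖ ^ 2 ≤ 2 * ‖v x‖ ^ 2 + 2 * ‖w x‖ ^ 2
  nlinarith

lemma MeasureTheory.MemLp.integrable_mul_fun {v w : Space d → ℝ}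
    (hv : MemLp v 2 (volume.restrict U)) (hw : MemLp w 2 (volume.restrict U)) :
    Integrable (fun x => v x * w x) (volume.restrict U) :=
  hv.integrable_mul hw

lemma MeasureTheory.MemLp.euclidean_apply {v : Space d → Space d}
    (hv : MemLp v 2 (volume.restrict U)) (i : Fin d) :
    MemLp (fun x => v x i) 2 (volume.restrict U) :=
  (EuclideanSpace.proj (𝕜 := ℝ) i).comp_memLp' hv

lemma LipschitzWith.memLp_comp {G : ℝ → ℝ} {K : ℝ≥0} (hG : LipschitzWith K G)
    [IsFiniteMeasure (volume.restrict U)] {v : Space d → ℝ}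
    (hv : MemLp v 2 (volume.restrict U)) :
    MemLp (fun x => G (v x)) 2 (volume.restrict U) := by
  -- Composition preserves `L²` once the value at `0` is normalized to `0`; the constant `G 0` is in
  -- `L²` because the measure is finite.
  have h₁ : LipschitzWith K (fun s => G s - G 0) :=
    LipschitzWith.of_dist_le_mul fun x y => by simpa using hG.dist_le_mul x y
  have h₂ := (h₁.comp_memLp (by simp) hv).add (memLp_const (G 0))
  refine h₂.ae_eq (Eventually.of_forall fun x => ?_)
  simp

/-- The integrated form of a pointwise estimate of Young type. -/
lemma integral_young_le [IsFiniteMeasure (volume.restrict U)] {p q w g h : Space d → ℝ}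
    (hp : MemLp p 2 (volume.restrict U)) (hq : MemLp q 2 (volume.restrict U))
    (hw : MemLp w 2 (volume.restrict U)) (hg : MemLp g 2 (volume.restrict U))
    (hh : MemLp h 2 (volume.restrict U)) {M e K : ℝ}
    (H : ∀ x, 2 * (M * ((p x - q x) * w x) - e * ((g x - h x) * w x)) ≤
      M * w x ^ 2 + (M * (p x - q x) ^ 2 + K)) :
    2 * (M * ((∫ x in U, p x * w x) - ∫ x in U, q x * w x)
        - e * ((∫ x in U, g x * w x) - ∫ x in U, h x * w x))
      ≤ M * l2Sq U w + (M * l2Sq U (fun x => p x - q x) + K * volume.real U) := by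
  have i₁ : Integrable (fun x => (p x - q x) * w x) (volume.restrict U) :=
    (hp.sub hq).integrable_mul_fun hw
  have i₂ : Integrable (fun x => (g x - h x) * w x) (volume.restrict U) :=
    (hg.sub hh).integrable_mul_fun hw
  have i₃ := hw.integrable_norm_sq.const_mul M
  have i₄ : Integrable (fun x => M * ‖p x - q x‖ ^ 2) (volume.restrict U) :=
    (hp.sub hq).integrable_norm_sq.const_mul M
  have i₅ : Integrable (fun x => M * ‖p x - q x‖ ^ 2 + K) (volume.restrict U) :=
    i₄.add (integrable_const K)
  have e₁ : (∫ x in U, p x * w x) - ∫ x in U, q x * w x = ∫ x in U, (p x - q x) * w x := by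
    rw [← integral_sub (hp.integrable_mul_fun hw) (hq.integrable_mul_fun hw)]
    simp only [sub_mul]
  have e₂ : (∫ x in U, g x * w x) - ∫ x in U, h x * w x = ∫ x in U, (g x - h x) * w x := by
    rw [← integral_sub (hg.integrable_mul_fun hw) (hh.integrable_mul_fun hw)]
    simp only [sub_mul]
  have hconst : K * volume.real U = ∫ _ in U, K := by
    simp [mul_comm]
  unfold l2Sq
  rw [e₁, e₂, hconst, ← integral_const_mul, ← integral_const_mul,
    ← integral_sub (i₁.const_mul M) (i₂.const_mul e), ← integral_const_mul, ← integral_const_mul,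
    ← integral_const_mul, ← integral_add i₄ (integrable_const K), ← integral_add i₃ i₅]
  refine integral_mono (((i₁.const_mul M).sub (i₂.const_mul e)).const_mul 2) (i₃.add i₅)
    fun x => ?_
  simpa only [Real.norm_eq_abs, sq_abs] using H x

end L2

/-! ### Test functions -/

section Smooth

variable {d : ℕ}

lemma ContDiff.continuous_gradient {φ : Space d → ℝ} (h : ContDiff ℝ ∞ φ) :
    Continuous (gradient φ) :=
  (InnerProductSpace.toDual ℝ (Space d)).symm.continuous.comp (h.continuous_fderiv (by simp))

lemma HasCompactSupport.gradient {φ : Space d → ℝ} (h : HasCompactSupport φ) :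
    HasCompactSupport (gradient φ) :=
  (h.fderiv (𝕜 := ℝ)).comp_left (g := (InnerProductSpace.toDual ℝ (Space d)).symm) (map_zero _)

lemma gradient_sub_of_contDiff {φ ψ : Space d → ℝ} (hφ : ContDiff ℝ ∞ φ) (hψ : ContDiff ℝ ∞ ψ)
    (x : Space d) : gradient (φ - ψ) x = gradient φ x - gradient ψ x := by
  unfold gradient
  rw [fderiv_sub (hφ.differentiable (by simp) x) (hψ.differentiable (by simp) x), map_sub]

end Smooth

/-! ### Differences in `H¹` -/

section H1

variable {d : ℕ} {U : Set (Space d)}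

/-- The difference of two functions of `H¹(U)`. -/
def H1.diff (u v : H1 U) : H1 U where
  val := fun x => u.val x - v.val x
  grad := fun x => u.grad x - v.grad x
  memLp_val := u.memLp_val.sub v.memLp_val
  memLp_grad := u.memLp_grad.sub v.memLp_grad
  weak_grad := by
    intro φ hφ hc hs i
    have hgi : MemLp (fun x => gradient φ x i) 2 (volume.restrict U) :=
      (hφ.continuous_gradient.memLp_of_hasCompactSupport hc.gradient).euclidean_apply i
    have hφ2 : MemLp φ 2 (volume.restrict U) := hφ.continuous.memLp_of_hasCompactSupport hc
    simp only [PiLp.sub_apply, sub_mul]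
    rw [integral_sub (u.memLp_val.integrable_mul_fun hgi) (v.memLp_val.integrable_mul_fun hgi),
      integral_sub ((u.memLp_grad.euclidean_apply i).integrable_mul_fun hφ2)
        ((v.memLp_grad.euclidean_apply i).integrable_mul_fun hφ2),
      u.weak_grad φ hφ hc hs i, v.weak_grad φ hφ hc hs i]
    ring

/-- Makes the increments of the iteration admissible as test functions and in the Poincaré
inequality. -/
lemma VanishesOn.diff {Γ : Set (Space d)} {u v : H1 U} (hu : VanishesOn Γ u)
    (hv : VanishesOn Γ v) : VanishesOn Γ (u.diff v) := by
  intro δ hδ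
  -- `l2Sq_sub_le` costs a factor `2`, and `2 (δ / 4 + δ / 4) = δ`.
  obtain ⟨φ, hφ, hφc, hφΓ, hφδ⟩ := hu (δ / 4) (by positivity)
  obtain ⟨ψ, hψ, hψc, hψΓ, hψδ⟩ := hv (δ / 4) (by positivity)
  refine ⟨φ - ψ, hφ.sub hψ, hφc.sub hψc, ?_, ?_⟩
  · exact (hφΓ.sup_left hψΓ).mono_left (tsupport_sub φ ψ)
  · have hφ2 := hφ.continuous.memLp_of_hasCompactSupport (p := 2) (μ := volume.restrict U) hφc
    have hψ2 := hψ.continuous.memLp_of_hasCompactSupport (p := 2) (μ := volume.restrict U) hψc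
    have hφ3 := hφ.continuous_gradient.memLp_of_hasCompactSupport (p := 2)
      (μ := volume.restrict U) hφc.gradient
    have hψ3 := hψ.continuous_gradient.memLp_of_hasCompactSupport (p := 2)
      (μ := volume.restrict U) hψc.gradient
    have h₁ := l2Sq_sub_le (u.memLp_val.sub hφ2) (v.memLp_val.sub hψ2)
    have h₂ := l2Sq_sub_le (u.memLp_grad.sub hφ3) (v.memLp_grad.sub hψ3)
    have e₁ : (fun x => (u.diff v).val x - (φ - ψ) x)
        = fun x => (u.val - φ) x - (v.val - ψ) x := by
      funext x
      simp only [H1.diff, Pi.sub_apply]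
      ring
    have e₂ : (fun x => (u.diff v).grad x - gradient (φ - ψ) x)
        = fun x => (u.grad - gradient φ) x - (v.grad - gradient ψ) x := by
      funext x
      rw [gradient_sub_of_contDiff hφ hψ]
      simp only [H1.diff, Pi.sub_apply]
      abel
    rw [e₁, e₂]
    change l2Sq U (u.val - φ) + l2Sq U (u.grad - gradient φ) < δ / 4 at hφδ
    change l2Sq U (v.val - ψ) + l2Sq U (v.grad - gradient ψ) < δ / 4 at hψδ
    linarith

end H1

/-! ### The bilinear form -/

section Bilinear

variable {d : ℕ} {U : Set (Space d)} {A : Space d → Matrix (Fin d) (Fin d) ℝ} {gLow gHigh : ℝ}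

lemma IsDiffusion.continuous_entry (hA : IsDiffusion A gLow gHigh) (i j : Fin d) :
    Continuous fun y => A y i j := by
  obtain ⟨L, hL⟩ := hA.lipschitz
  exact (hL i j).continuous

/-- The entries are continuous, so a bound on a set of full measure, which is dense, holds
everywhere. -/
lemma IsDiffusion.exists_bound (hA : IsDiffusion A gLow gHigh) :
    ∃ B : ℝ, ∀ y i j, |A y i j| ≤ B := by
  obtain ⟨B, hB⟩ := hA.ess_bounded
  refine ⟨B, fun y i j => ?_⟩
  have hclosed : IsClosed {y | |A y i j| ≤ B} :=
    isClosed_le (hA.continuous_entry i j).abs continuous_const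
  have hdense : Dense {y | |A y i j| ≤ B} :=
    Measure.dense_of_ae (hB.mono fun y hy => hy i j)
  have : y ∈ closure {y | |A y i j| ≤ B} := hdense y
  rwa [hclosed.closure_eq] at this

lemma IsDiffusion.integrable_form (hA : IsDiffusion A gLow gHigh) (ε : ℝ) (u φ : H1 U) :
    Integrable (fun x => ∑ i, ∑ j, A (ε⁻¹ • x) i j * (u.grad x) j * (φ.grad x) i)
      (volume.restrict U) := by
  obtain ⟨B, hB⟩ := hA.exists_bound
  refine integrable_finsetSum _ fun i _ => integrable_finsetSum _ fun j _ => ?_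
  have h := (u.memLp_grad.euclidean_apply j).integrable_mul_fun (φ.memLp_grad.euclidean_apply i)
  have hcont : Continuous fun x : Space d => A (ε⁻¹ • x) i j :=
    (hA.continuous_entry i j).comp (continuous_const_smul _)
  refine (h.bdd_mul (c := B) hcont.aestronglyMeasurable
    (Eventually.of_forall fun x => hB _ i j)).congr (Eventually.of_forall fun x => ?_)
  simp [mul_assoc]

lemma IsDiffusion.bilinearForm_diff (hA : IsDiffusion A gLow gHigh) (ε : ℝ) (u v φ : H1 U) :
    bilinearForm A ε (u.diff v) φ = bilinearForm A ε u φ - bilinearForm A ε v φ := by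
  unfold bilinearForm
  rw [← integral_sub (hA.integrable_form ε u φ) (hA.integrable_form ε v φ)]
  refine integral_congr_ae (Eventually.of_forall fun x => ?_)
  simp [H1.diff, mul_sub, sub_mul, Finset.sum_sub_distrib]

lemma IsDiffusion.le_bilinearForm (hA : IsDiffusion A gLow gHigh) (ε : ℝ) (u : H1 U) :
    gLow * l2Sq U u.grad ≤ bilinearForm A ε u u := by
  unfold bilinearForm l2Sq
  rw [← integral_const_mul]
  refine integral_mono (u.memLp_grad.integrable_norm_sq.const_mul _) (hA.integrable_form ε u u)
    fun x => ?_
  refine (hA.elliptic (ε⁻¹ • x) (u.grad x)).1.trans_eq ?_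
  exact Finset.sum_congr rfl fun i _ => Finset.sum_congr rfl fun j _ => by ring

end Bilinear

/-! ### The contraction estimate for the iterates -/

section Iteration

variable {d : ℕ} {Ω Ys : Set (Space d)}

lemma perforated_subset (ε : ℝ) : perforated Ω Ys ε ⊆ Ω := sdiff_subset

/-- One step of the iteration contracts the increments, up to the regularization error. -/
lemma IsIteration.step {Cp : ℝ} (hΩ : Bornology.IsBounded Ω)
    (hCp : IsPoincareConstant Ω Ys Cp) {A : Space d → Matrix (Fin d) (Fin d) ℝ}
    {gLow gHigh : ℝ} (hA : IsDiffusion A gLow gHigh) {R : ℝ → ℝ} {δ₀ δ₁ : ℝ} (hδ₀ : 0 < δ₀)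
    {f : Space d → ℝ} {α η σ CR : ℝ} (hα : 0 ≤ α)
    (hη : 0 < η) (hσ : 0 < σ) {γ : ℕ → ℝ} {Rreg : ℝ → ℝ → ℝ} {ε : ℝ}
    (hε : ε ∈ admissibleScales Ω Ys) {M : ℝ} (hM : M = η + ε ^ α * δ₁)
    {u : ℕ → H1 (perforated Ω Ys ε)} (hu : IsIteration Ω Ys A f α M ε γ Rreg u) {k : ℕ}
    (hk : 1 ≤ k) (hγ : γ (k + 1) ≤ γ k)
    (hreg : IsRegularization R δ₀ δ₁ CR σ (γ k) (Rreg (γ k)))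
    (hreg' : IsRegularization R δ₀ δ₁ CR σ (γ (k + 1)) (Rreg (γ (k + 1)))) :
    gLow * l2Sq (perforated Ω Ys ε) ((u (k + 1)).diff (u k)).grad
        + (gLow * Cp⁻¹ + M) * l2Sq (perforated Ω Ys ε) ((u (k + 1)).diff (u k)).val
      ≤ M * l2Sq (perforated Ω Ys ε) ((u k).diff (u (k - 1))).val
        + 8 * CR ^ 2 / δ₀ * (γ k ^ (2 * σ) / γ (k + 1)) * volume.real Ω := by
  have hε0 : 0 < ε := hε.1
  have hΩfin : volume Ω < ⊤ := hΩ.measure_lt_top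
  have hUfin : volume (perforated Ω Ys ε) < ⊤ :=
    (measure_mono (perforated_subset ε)).trans_lt hΩfin
  have : IsFiniteMeasure (volume.restrict (perforated Ω Ys ε)) :=
    isFiniteMeasure_restrict.2 hUfin.ne
  set w := (u (k + 1)).diff (u k) with hw
  set v := (u k).diff (u (k - 1)) with hv
  set e := ε ^ α with he
  have he0 : 0 < e := Real.rpow_pos_of_pos hε0 α
  have he1 : e ≤ 1 := Real.rpow_le_one hε0.le hε.2.1 hα
  have hwV : w ∈ spaceV Ω Ys ε := (hu.mem_spaceV (k + 1)).diff (hu.mem_spaceV k)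
  have hgL := hA.gLow_pos
  have hpoinc : gLow * Cp⁻¹ * l2Sq (perforated Ω Ys ε) w.val
      ≤ gLow * l2Sq (perforated Ω Ys ε) w.grad := by
    have h₁ := hCp.2 ε hε w hwV
    have hC := hCp.1
    rw [mul_assoc]
    gcongr
    rwa [inv_mul_le_iff₀ hC]
  have e₁ := hu.equation (k + 1) (by omega) w hwV
  have e₂ := hu.equation k hk w hwV
  rw [Nat.add_sub_cancel] at e₁
  obtain ⟨K, hK⟩ := hreg.lipschitz
  obtain ⟨K', hK'⟩ := hreg'.lipschitz
  have i₁ := (u (k + 1)).memLp_val.integrable_mul_fun w.memLp_val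
  have i₂ := (u k).memLp_val.integrable_mul_fun w.memLp_val
  have hww : l2Sq (perforated Ω Ys ε) w.val =
      (∫ x in perforated Ω Ys ε, (u (k + 1)).val x * w.val x)
      - ∫ x in perforated Ω Ys ε, (u k).val x * w.val x := by
    rw [← integral_sub i₁ i₂]
    refine integral_congr_ae (Eventually.of_forall fun x => ?_)
    simp only [hw, H1.diff, Real.norm_eq_abs, sq_abs]
    ring
  set K₀ := 8 * CR ^ 2 / δ₀ * (γ k ^ (2 * σ) / γ (k + 1)) with hK₀
  have hrhs := integral_young_le (U := perforated Ω Ys ε) (u k).memLp_val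
    (u (k - 1)).memLp_val w.memLp_val
    (hK'.memLp_comp (u k).memLp_val) (hK.memLp_comp (u (k - 1)).memLp_val)
    (fun x => hreg'.young_le hδ₀ hσ hreg hγ hη he0 he1 hM ((u k).val x) ((u (k - 1)).val x)
      (w.val x))
  rw [← hK₀] at hrhs
  change _ ≤ M * l2Sq (perforated Ω Ys ε) w.val
    + (M * l2Sq (perforated Ω Ys ε) v.val + K₀ * volume.real (perforated Ω Ys ε)) at hrhs
  -- Passing to the volume of `Ω` removes the dependence on `ε`.
  have hvol : K₀ * volume.real (perforated Ω Ys ε) ≤ K₀ * volume.real Ω := by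
    have h₁ := hreg.γ_pos
    have h₂ := hreg'.γ_pos
    have : 0 ≤ K₀ := by
      rw [hK₀]
      have := Real.rpow_nonneg h₁.le (2 * σ)
      positivity
    exact mul_le_mul_of_nonneg_left
      (measureReal_mono (perforated_subset ε) hΩfin.ne) this
  have hform := hA.le_bilinearForm ε w
  have hdiff := hA.bilinearForm_diff ε (u (k + 1)) (u k) w
  rw [← hw] at hdiff
  have hMw : M * l2Sq (perforated Ω Ys ε) w.val =
      M * (∫ x in perforated Ω Ys ε, (u (k + 1)).val x * w.val x)
      - M * ∫ x in perforated Ω Ys ε, (u k).val x * w.val x := by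
    rw [hww]
    ring
  -- Twice the difference `e₁ - e₂` contains two copies of the form. One keeps the gradient term,
  -- the other becomes `gLow * Cp⁻¹` times `‖w‖²` by `hpoinc`; Young's `M ‖w‖²` cancels one of the
  -- two on the left.
  linarith

end Iteration

/-- Iterating `b (k+1) ≤ ρ b k + E (k+1)`. -/
lemma le_sum_of_contraction {b E : ℕ → ℝ} {ρ : ℝ} (hρ : 0 ≤ ρ)
    (h : ∀ k, 1 ≤ k → b (k + 1) ≤ ρ * b k + E (k + 1)) :
    ∀ k, 1 ≤ k → b k ≤ ∑ j ∈ Finset.Icc 2 k, ρ ^ (k - j) * E j + b 1 * ρ ^ (k - 1) := by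
  intro k hk
  induction k, hk using Nat.le_induction with
  | base => simp
  | succ k hk ih =>
    have hstep := (h k hk).trans (add_le_add_left (mul_le_mul_of_nonneg_left ih hρ) _)
    refine hstep.trans_eq ?_
    rw [Finset.sum_Icc_succ_top (by omega), mul_add, Finset.mul_sum]
    have hs : ∑ j ∈ Finset.Icc 2 k, ρ * (ρ ^ (k - j) * E j)
        = ∑ j ∈ Finset.Icc 2 k, ρ ^ (k + 1 - j) * E j := by
      refine Finset.sum_congr rfl fun j hj => ?_
      rw [Nat.succ_sub (Finset.mem_Icc.1 hj).2, pow_succ]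
      ring
    have hp : ρ ^ (k + 1 - 1) = ρ ^ (k - 1) * ρ := by
      rw [← pow_succ]
      congr 1
      omega
    rw [hs, hp]
    simp
    ring

/-! ### The error estimate. -/

theorem mainTheorem3
    {d : ℕ} (hd : d = 2 ∨ d = 3)
    (Ω Ys : Set (Space d)) (hΩ : IsPolygonalDomain Ω)
    (hYs : IsCompact Ys) (hYsY : Ys ⊆ openUnitCell d)
    (Cp : ℝ) (hCp : IsPoincareConstant Ω Ys Cp)
    (A : Space d → Matrix (Fin d) (Fin d) ℝ) (gLow gHigh : ℝ) (hA : IsDiffusion A gLow gHigh)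
    (R : ℝ → ℝ) (x₀ δ₀ δ₁ : ℝ) (hR : IsDegenerateAt R x₀ δ₀ δ₁)
    (f : Space d → ℝ) (hf : MemLp f 2 (volume.restrict Ω))
    (α : ℝ) (hα : 0 ≤ α) (η : ℝ) (hη : 0 < η) (σ : ℝ) (hσ : 0 < σ) (CR : ℝ) :
    ∃ C : ℝ, 0 < C ∧
      ∀ (γ : ℕ → ℝ) (Rreg : ℝ → ℝ → ℝ),
        (∀ k, 1 ≤ k → 0 < γ k) →
        (∀ k, 1 ≤ k → γ (k + 1) ≤ γ k) →
        (∀ k, 1 ≤ k → IsRegularization R δ₀ δ₁ CR σ (γ k) (Rreg (γ k))) →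
      ∀ ε ∈ admissibleScales Ω Ys,
      ∀ M : ℝ, M = η + ε ^ α * δ₁ →
      ∀ u : ℕ → H1 (perforated Ω Ys ε), IsIteration Ω Ys A f α M ε γ Rreg u →
      ∀ k : ℕ, 2 ≤ k →
        gLow / (η + δ₁ + gLow * Cp⁻¹)
            * l2Sq (perforated Ω Ys ε) (fun x => (u k).grad x - (u (k - 1)).grad x)
          + l2Sq (perforated Ω Ys ε) (fun x => (u k).val x - (u (k - 1)).val x)
        ≤ C * γ (k - 1) ^ (2 * σ) / γ k
          + C * ∑ j ∈ Finset.Icc 2 (k - 1),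
              (M / (gLow * Cp⁻¹ + M)) ^ (k - j) * (γ (j - 1) ^ (2 * σ) / γ j)
          + l2Sq (perforated Ω Ys ε) (u 1).val * (M / (gLow * Cp⁻¹ + M)) ^ (k - 1) := by
  have hgL := hA.gLow_pos
  have hCp0 := hCp.1
  have hδ₀ := hR.δ₀_pos
  have hδ₁ := hR.δ₁_pos
  set κ := gLow * Cp⁻¹ with hκ
  have hκ0 : 0 < κ := by positivity
  -- The step error is divided by `κ + M ≥ κ`, which removes `M`, hence `ε`, from the constant. The
  -- `+ 1` keeps it positive when `CR = 0`.
  refine ⟨8 * CR ^ 2 / δ₀ * volume.real Ω / κ + 1, by positivity, ?_⟩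
  set C := 8 * CR ^ 2 / δ₀ * volume.real Ω / κ + 1 with hC
  intro γ Rreg hγ0 hγ hreg ε hε M hM
  set U := perforated Ω Ys ε with hU
  intro u hu k hk
  have he0 : 0 < ε ^ α := Real.rpow_pos_of_pos hε.1 α
  have he1 : ε ^ α ≤ 1 := Real.rpow_le_one hε.1.le hε.2.1 hα
  have hM0 : 0 < M := by
    rw [hM]
    positivity
  -- This replaces the `ε`-dependent gradient weight `gLow / (κ + M)` by the smaller `lam`.
  have hMle : κ + M ≤ η + δ₁ + κ := by
    have : ε ^ α * δ₁ ≤ 1 * δ₁ := by gcongr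
    linarith
  set ρ := M / (κ + M) with hρ
  have hρ0 : 0 ≤ ρ := by positivity
  set lam := gLow / (η + δ₁ + κ) with hlam
  set b : ℕ → ℝ := fun k => l2Sq U ((u k).diff (u (k - 1))).val with hb
  set E : ℕ → ℝ := fun j => C * (γ (j - 1) ^ (2 * σ) / γ j) with hE
  have hstep : ∀ k, 1 ≤ k →
      lam * l2Sq U ((u (k + 1)).diff (u k)).grad + b (k + 1) ≤ ρ * b k + E (k + 1) := by
    intro k hk
    have h := hu.step hΩ.isBounded hCp hA hδ₀ hα hη hσ hε hM hk (hγ k hk) (hreg k hk)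
      (hreg (k + 1) (by omega))
    have hD := l2Sq_nonneg (U := U) ((u (k + 1)).diff (u k)).grad
    set D := l2Sq U ((u (k + 1)).diff (u k)).grad
    have h₁ : lam * D ≤ gLow * D / (κ + M) := by
      rw [hlam, div_mul_eq_mul_div]
      gcongr
    have hrat : 0 ≤ γ k ^ (2 * σ) / γ (k + 1) :=
      div_nonneg (Real.rpow_nonneg (hγ0 k hk).le _) (hγ0 (k + 1) (by omega)).le
    have h₂ : 8 * CR ^ 2 / δ₀ * (γ k ^ (2 * σ) / γ (k + 1)) * volume.real Ω / (κ + M)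
        ≤ C * (γ k ^ (2 * σ) / γ (k + 1)) := by
      calc _ = 8 * CR ^ 2 / δ₀ * volume.real Ω / (κ + M) * (γ k ^ (2 * σ) / γ (k + 1)) := by ring
        _ ≤ C * (γ k ^ (2 * σ) / γ (k + 1)) := by
          gcongr
          rw [hC]
          have : 8 * CR ^ 2 / δ₀ * volume.real Ω / (κ + M)
              ≤ 8 * CR ^ 2 / δ₀ * volume.real Ω / κ := by
            gcongr
            linarith
          linarith
    have hpos : 0 < κ + M := by positivity
    have h₃ := div_le_div_of_nonneg_right h hpos.le
    rw [add_div, add_div, mul_div_cancel_left₀ _ hpos.ne'] at h₃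
    have h₄ : M * b k / (κ + M) = ρ * b k := by
      rw [hρ]
      ring
    change gLow * D / (κ + M) + b (k + 1) ≤ M * b k / (κ + M)
      + 8 * CR ^ 2 / δ₀ * (γ k ^ (2 * σ) / γ (k + 1)) * volume.real Ω / (κ + M) at h₃
    change lam * D + b (k + 1) ≤ ρ * b k + C * (γ k ^ (2 * σ) / γ (k + 1))
    linarith
  have hlam0 : 0 ≤ lam := by positivity
  have hstep' : ∀ k, 1 ≤ k → b (k + 1) ≤ ρ * b k + E (k + 1) := fun k hk => by
    have h₁ := hstep k hk
    have h₂ := mul_nonneg hlam0 (l2Sq_nonneg (U := U) ((u (k + 1)).diff (u k)).grad)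
    linarith
  obtain ⟨n, rfl⟩ : ∃ n, k = n + 1 := ⟨k - 1, by omega⟩
  have hn : 1 ≤ n := by omega
  -- The iterated bound, without gradients, is used only up to `n = k - 1`. The last step is
  -- `hstep`, which keeps the gradient and leaves its error outside the sum.
  have hg := le_sum_of_contraction hρ0 hstep' n hn
  have hb1 : b 1 = l2Sq U (u 1).val := by
    refine integral_congr_ae ?_
    filter_upwards [hu.initial] with x hx
    simp [H1.diff, hx]
  have hfinal := (hstep n hn).trans (add_le_add_left (mul_le_mul_of_nonneg_left hg hρ0) _)
  refine hfinal.trans_eq ?_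
  rw [hb1, mul_add, Finset.mul_sum, Finset.mul_sum, Nat.add_sub_cancel]
  have hs : ∑ j ∈ Finset.Icc 2 n, ρ * (ρ ^ (n - j) * E j)
      = ∑ j ∈ Finset.Icc 2 n, C * (ρ ^ (n + 1 - j) * (γ (j - 1) ^ (2 * σ) / γ j)) := by
    refine Finset.sum_congr rfl fun j hj => ?_
    rw [Nat.succ_sub (Finset.mem_Icc.1 hj).2, pow_succ]
    simp only [hE]
    ring
  have hp : ρ ^ n = ρ ^ (n - 1) * ρ := by
    rw [← pow_succ]
    congr 1
    omega
  rw [hs, hp]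
  simp only [hE, Nat.add_sub_cancel]
  ring
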